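/- Let $n \ge 2$ and $\kappa \in [0,1]$. For $\delta>0$ and $E \subset \mathbb{R}^n$ let $$\mathcal{H}^{\delta}_\infty(E) := \inf \Big\{ \sum_{i} r_i^{\delta} : E \subset \bigcup_{i} B(x_i,r_i) \Big\}$$ be the $\delta$-dimensional Hausdorff content, the infimum being taken over all countable or finite collections of open balls that cover $E$ (so that the value may be $\infty$). Let $W^{1,1}_0(\mathbb{R}^n)$ be the closure of $C^\infty_0(\mathbb{R}^n)$ with respect to the norm $\|u\|_1 + \|\nabla u\|_1$, where $\nabla u$ is the weak gradient. Then there exists a constant $c>0$, depending only on $n$ and $\kappa$, such that $$\|u\|_{\infty} \le c \int_{\mathbb{R}^n} \frac{|\nabla u (x)|}{\Big(\mathcal{H}^{n-\kappa}_\infty \big(\{y \in \mathbb{R}^n : u(y) \ge u(x)\}\big)\Big)^{\frac{n-1}{n-\kappa}}} \, dx$$ for all non-negative, continuous functions $u \in W^{1,1}_0(\mathbb{R}^n)$ with compact support in $\mathbb{R}^n$. Here $\|u\|_\infty$ is the essential supremum of $|u|$, the integral is a Lebesgue integral with values in $[0,\infty]$, and in the integrand $0/0 = 0$, $a/0=\infty$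 for $a>0$, and $a/\infty=0$. -/

import Mathlib

open MeasureTheory
open scoped ENNReal NNReal ContDiff

/-- The `δ`-dimensional Hausdorff content of `E`: the infimum of `∑ i, (r i) ^ δ` over the countable
or finite families of open balls that cover `E`. Radius `0` is allowed: such a ball is empty and, for
`δ > 0`, adds `0` to the sum, so that finite families are covered as well. -/
noncomputable def hausdorffContent {X : Type*} [PseudoMetricSpace X] (δ : ℝ) (E : Set X) : ℝ≥0∞ :=
  ⨅ (x : ℕ → X) (r : ℕ → ℝ≥0) (_ : E ⊆ ⋃ i, Metric.ball (x i) (r i : ℝ)),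
    ∑' i, (r i : ℝ≥0∞) ^ δ

/-- `Du` is a weak gradient of `u` on `ℝⁿ`: both are locally integrable and
`∫ u ∇φ = - ∫ φ Du` for all test functions `φ ∈ C_0^∞(ℝⁿ)`. -/
def HasWeakGradient {n : ℕ} (u : EuclideanSpace ℝ (Fin n) → ℝ)
    (Du : EuclideanSpace ℝ (Fin n) → EuclideanSpace ℝ (Fin n)) : Prop :=
  LocallyIntegrable u volume ∧ LocallyIntegrable Du volume ∧
    ∀ φ : EuclideanSpace ℝ (Fin n) → ℝ, ContDiff ℝ ∞ φ → HasCompactSupport φ →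
      ∫ x, u x • gradient φ x = - ∫ x, φ x • Du x

/-- `u ∈ W_0^{1,1}(ℝⁿ)`: `u` and its weak gradient are integrable, and `u` lies in the closure of
`C_0^∞(ℝⁿ)` with respect to the norm `‖u‖₁ + ‖∇u‖₁`. -/
def MemW110 {n : ℕ} (u : EuclideanSpace ℝ (Fin n) → ℝ) : Prop :=
  ∃ Du : EuclideanSpace ℝ (Fin n) → EuclideanSpace ℝ (Fin n),
    HasWeakGradient u Du ∧ Integrable u volume ∧ Integrable Du volume ∧
    ∀ ε : ℝ≥0∞, 0 < ε → ∃ φ : EuclideanSpace ℝ (Fin n) → ℝ,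
      ContDiff ℝ ∞ φ ∧ HasCompactSupport φ ∧
      (∫⁻ x, ‖u x - φ x‖ₑ) + (∫⁻ x, ‖Du x - gradient φ x‖ₑ) < ε

/-! Since `ℓ^p` norms decrease in `p`, the power of the (n-κ)-content in the denominator is at most
the (n-1)-content, so κ = 1 is the worst case. Write h(t) for the (n-1)-content of {u ≥ t}.

The core is a capacitary boxing inequality, (T - S) h(T) ≤ C ∫_{S<u<T} |∇u|. Around each point of {u
≥ T} one picks a ball in which a superlevel set and its complement both have a fixed share of the
volume. A relative isoperimetric inequality between two levels bounds r^(n-1) by the gradient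
integral over the slab near that ball, and a Vitali selection adds these bounds up. This needs a
slab of small volume; cutting (S, (S+T)/2) into many slabs makes at least half of them thin.

For M = u(x₀) > 0, cut [M/4, 3M/4] into N slabs of height d. Boxing bounds the weighted gradient
integral over each slab below by a multiple of d h(t_{i+1}) / h(t_i). Single ratios may be small,
but their product is h(3M/4) / h(M/4), so for large N they average at least 1/2 and the total is
comparable to M. This works at every x₀ and bounds the supremum. -/

/-! ### Hausdorff content -/

theorem hausdorffContent_le_tsum {X ι : Type*} [PseudoMetricSpace X] [Nonempty X] [Countable ι]
    {δ : ℝ} (hδ : 0 < δ) {E : Set X} (x : ι → X) (r : ι → ℝ≥0)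
    (h : E ⊆ ⋃ i, Metric.ball (x i) (r i : ℝ)) :
    hausdorffContent δ E ≤ ∑' i, (r i : ℝ≥0∞) ^ δ := by
  obtain ⟨f, hf⟩ := exists_injective_nat ι
  let x₀ : X := Classical.arbitrary X
  -- Indices outside the range of `f` get radius 0: an empty ball that costs `0 ^ δ = 0`.
  refine (iInf₂_le_of_le (Function.extend f x fun _ => x₀) (Function.extend f r 0)
    (iInf_le _ ?_)).trans (le_of_eq ?_)
  · intro y hy
    obtain ⟨i, hi⟩ := Set.mem_iUnion.1 (h hy)
    refine Set.mem_iUnion.2 ⟨f i, ?_⟩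
    rwa [hf.extend_apply, hf.extend_apply]
  · rw [← tsum_extend_zero hf]
    congr 1
    ext j
    by_cases hj : ∃ i, f i = j
    · obtain ⟨i, rfl⟩ := hj
      simp [hf.extend_apply]
    · simp [Function.extend_apply' _ _ _ hj, hδ]

theorem hausdorffContent_mono {X : Type*} [PseudoMetricSpace X] {δ : ℝ} {E F : Set X}
    (h : E ⊆ F) : hausdorffContent δ E ≤ hausdorffContent δ F :=
  le_iInf fun x => le_iInf fun r => le_iInf fun hF =>
    iInf₂_le_of_le x r (iInf_le _ (h.trans hF))

/-- Each `a i ^ p` is at most the whole sum, so the surplus factor `a i ^ (q - p)` can be pulled out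
as a power of it. -/
theorem ENNReal.tsum_rpow_le_rpow_tsum {ι : Type*} (a : ι → ℝ≥0∞) {p q : ℝ} (hp : 0 < p)
    (hpq : p ≤ q) : ∑' i, a i ^ q ≤ (∑' i, a i ^ p) ^ (q / p) := by
  set S := ∑' i, a i ^ p with hS
  have h1 : ∀ i, a i ^ q ≤ a i ^ p * S ^ ((q - p) / p) := by
    intro i
    have h2 : a i ^ p ≤ S := ENNReal.le_tsum i
    calc a i ^ q = a i ^ p * a i ^ (q - p) := by
          rw [← ENNReal.rpow_add_of_nonneg _ _ hp.le (by linarith)]; congr 1; ring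
      _ = a i ^ p * (a i ^ p) ^ ((q - p) / p) := by
          rw [← ENNReal.rpow_mul]; congr 2; field_simp
      _ ≤ _ := by
          gcongr
  calc ∑' i, a i ^ q ≤ ∑' i, a i ^ p * S ^ ((q - p) / p) := ENNReal.tsum_le_tsum h1
    _ = S ^ (1 : ℝ) * S ^ ((q - p) / p) := by rw [ENNReal.tsum_mul_right, ENNReal.rpow_one]
    _ = _ := by
      rw [← ENNReal.rpow_add_of_nonneg _ _ zero_le_one (div_nonneg (by linarith) hp.le)]
      congr 1; field_simp; ring_nf

theorem hausdorffContent_rpow_le {X : Type*} [PseudoMetricSpace X] {p q : ℝ} (hp : 0 < p)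
    (hpq : p ≤ q) (E : Set X) :
    hausdorffContent q E ^ (p / q) ≤ hausdorffContent p E := by
  have hq : 0 < q := hp.trans_le hpq
  refine le_iInf fun x => le_iInf fun r => le_iInf fun hE => ?_
  have h1 : hausdorffContent q E ≤ (∑' i, (r i : ℝ≥0∞) ^ p) ^ (q / p) :=
    (iInf₂_le_of_le x r (iInf_le _ hE)).trans (ENNReal.tsum_rpow_le_rpow_tsum _ hp hpq)
  calc _ ≤ ((∑' i, (r i : ℝ≥0∞) ^ p) ^ (q / p)) ^ (p / q) := by gcongr
    _ = _ := by
      rw [← ENNReal.rpow_mul, div_mul_div_cancel₀ hp.ne', div_self hq.ne', ENNReal.rpow_one]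

theorem hausdorffContent_lt_top_of_isBounded {X : Type*} [PseudoMetricSpace X] [Nonempty X]
    {δ : ℝ} (hδ : 0 < δ) {E : Set X} (hE : Bornology.IsBounded E) :
    hausdorffContent δ E < ⊤ := by
  obtain ⟨R, hR⟩ := hE.subset_ball (Classical.arbitrary X)
  refine (hausdorffContent_le_tsum (ι := Unit) hδ (fun _ => Classical.arbitrary X)
    (fun _ => R.toNNReal) fun y hy => Set.mem_iUnion.2 ⟨(), ?_⟩).trans_lt ?_
  · exact Metric.ball_subset_ball (Real.le_coe_toNNReal R) (hR hy)
  · rw [tsum_fintype, Finset.univ_unique, Finset.sum_singleton]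
    exact ENNReal.rpow_lt_top_of_nonneg hδ.le ENNReal.coe_ne_top

/-- For exponent `n` the content dominates Lebesgue measure up to a constant; smaller exponents
follow by comparison of contents. -/
theorem hausdorffContent_pos_of_isOpen {n : ℕ} {δ : ℝ} (hδ : 0 < δ) (hδn : δ ≤ n)
    {U : Set (EuclideanSpace ℝ (Fin n))} (hU : IsOpen U) (hne : U.Nonempty) :
    0 < hausdorffContent δ U := by
  have hn : (0 : ℝ) < n := hδ.trans_le hδn
  have hfr : Module.finrank ℝ (EuclideanSpace ℝ (Fin n)) = n := by simp
  set V := volume (Metric.ball (0 : EuclideanSpace ℝ (Fin n)) 1) with hV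
  have hV_top : V ≠ ⊤ := Metric.isBounded_ball.measure_lt_top.ne
  have hlow : volume U / V ≤ hausdorffContent (n : ℝ) U := by
    refine le_iInf fun x => le_iInf fun r => le_iInf fun hc => ?_
    refine ENNReal.div_le_of_le_mul ?_
    calc volume U ≤ ∑' i, volume (Metric.ball (x i) (r i : ℝ)) :=
          (measure_mono hc).trans (measure_iUnion_le _)
      _ = ∑' i, (r i : ℝ≥0∞) ^ (n : ℝ) * V := by
          congr 1; ext i
          have : Nontrivial (EuclideanSpace ℝ (Fin n)) :=
            Module.nontrivial_of_finrank_pos (R := ℝ) (by rw [hfr]; exact_mod_cast hn)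
          rw [Measure.addHaar_ball volume _ (r i).coe_nonneg, hfr]
          simp [ENNReal.ofReal_pow, hV]
      _ = _ := ENNReal.tsum_mul_right
  have hpos : 0 < hausdorffContent (n : ℝ) U :=
    (ENNReal.div_pos (hU.measure_pos volume hne).ne' hV_top).trans_le hlow
  refine lt_of_lt_of_le ?_ (hausdorffContent_rpow_le hδ hδn U)
  exact ENNReal.rpow_pos_of_nonneg hpos (div_pos hδ hn).le

/-! ### Relative isoperimetric inequality for C¹ functions -/

theorem Real.exists_abs_deriv_smoothTransition_le :
    ∃ L : ℝ≥0, ∀ y : ℝ, ‖deriv Real.smoothTransition y‖ₑ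
      ≤ Set.indicator (Set.Icc 0 1) (fun _ => (L : ℝ≥0∞)) y := by
  have hcont : Continuous (deriv Real.smoothTransition) :=
    (Real.smoothTransition.contDiff (n := 1)).continuous_deriv le_rfl
  obtain ⟨L, hL⟩ := (isCompact_Icc (a := (0 : ℝ)) (b := 1)).exists_bound_of_continuousOn
    hcont.continuousOn
  refine ⟨L.toNNReal, fun y => ?_⟩
  by_cases hy : y ∈ Set.Icc (0 : ℝ) 1
  · rw [Set.indicator_of_mem hy, ← ofReal_norm]
    exact ENNReal.ofReal_le_ofReal (hL y hy)
  · rw [Set.indicator_of_notMem hy]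
    have : deriv Real.smoothTransition y = 0 := by
      rw [Set.mem_Icc, not_and_or, not_le, not_le] at hy
      rcases hy with hy | hy
      · have : Real.smoothTransition =ᶠ[nhds y] fun _ => 0 := by
          filter_upwards [Iio_mem_nhds hy] with z hz
          exact Real.smoothTransition.zero_of_nonpos (le_of_lt hz)
        rw [this.deriv_eq, deriv_const]
      · have : Real.smoothTransition =ᶠ[nhds y] fun _ => 1 := by
          filter_upwards [Ioi_mem_nhds hy] with z hz
          exact Real.smoothTransition.one_of_one_le (le_of_lt hz)
        rw [this.deriv_eq, deriv_const]
    simp [this]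

/-- A smooth step applied to `(w - s) / (t - s)` climbs from 0 to 1 along the segment, and its
derivative vanishes outside the slab. The fundamental theorem of calculus gives the bound, with `L`
the sup of the step's derivative, independent of `E` and `w`. -/
theorem exists_segment_estimate :
    ∃ L : ℝ≥0, ∀ {E : Type} [NormedAddCommGroup E] [NormedSpace ℝ E] (w : E → ℝ),
      ContDiff ℝ 1 w → ∀ (s t : ℝ), s < t → ∀ x h : E, w x ≤ s → t ≤ w (x + h) →
      ENNReal.ofReal (t - s) ≤ L * ‖h‖ₑ * ∫⁻ τ in Set.Ioc (0 : ℝ) 1,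
        Set.indicator (w ⁻¹' Set.Icc s t) (fun z => ‖fderiv ℝ w z‖ₑ) (x + τ • h) := by
  obtain ⟨L, hL⟩ := Real.exists_abs_deriv_smoothTransition_le
  refine ⟨L, fun {E} _ _ w hw s t hst x h hx hxh => ?_⟩
  have hd : 0 < t - s := sub_pos.2 hst
  let σ := Real.smoothTransition
  have hσ : ContDiff ℝ 1 σ := Real.smoothTransition.contDiff
  have hσd : Differentiable ℝ σ := hσ.differentiable one_ne_zero
  have hwd : Differentiable ℝ w := hw.differentiable one_ne_zero
  let ℓ : ℝ → ℝ := fun τ => (w (x + τ • h) - s) / (t - s)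
  have hℓ : ∀ τ, HasDerivAt ℓ (fderiv ℝ w (x + τ • h) h / (t - s)) τ := by
    intro τ
    have h1 : HasDerivAt (fun τ : ℝ => x + τ • h) h τ := by
      simpa using ((hasDerivAt_id τ).smul_const h).const_add x
    exact (((hwd _).hasFDerivAt.comp_hasDerivAt τ h1).sub_const s).div_const _
  let g' : ℝ → ℝ := fun τ => deriv σ (ℓ τ) * (fderiv ℝ w (x + τ • h) h / (t - s))
  have hg : ∀ τ, HasDerivAt (σ ∘ ℓ) (g' τ) τ := fun τ =>
    (hσd _).hasDerivAt.comp τ (hℓ τ)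
  have hℓc : Continuous ℓ := continuous_iff_continuousAt.2 fun τ => (hℓ τ).continuousAt
  have hg'c : Continuous g' := by
    have h2 : Continuous (deriv σ) := hσ.continuous_deriv le_rfl
    have h3 : Continuous (fderiv ℝ w) := hw.continuous_fderiv one_ne_zero
    refine (h2.comp hℓc).mul (Continuous.div_const ?_ _)
    exact (h3.comp (by fun_prop)).clm_apply continuous_const
  have hint : ∫ τ in (0 : ℝ)..1, g' τ = 1 := by
    rw [intervalIntegral.integral_eq_sub_of_hasDerivAt (fun τ _ => hg τ)
      (hg'c.intervalIntegrable _ _)]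
    have h1 : σ (ℓ 1) = 1 := Real.smoothTransition.one_of_one_le (by
      simp only [ℓ, one_smul]; rw [le_div_iff₀ hd]; linarith)
    have h0 : σ (ℓ 0) = 0 := Real.smoothTransition.zero_of_nonpos (by
      simp only [ℓ, zero_smul, add_zero]; exact div_nonpos_of_nonpos_of_nonneg (by linarith) hd.le)
    simp [h0, h1]
  rw [intervalIntegral.integral_of_le zero_le_one] at hint
  have hpt : ∀ τ, ENNReal.ofReal (t - s) * ‖g' τ‖ₑ ≤ L * ‖h‖ₑ *
      Set.indicator (w ⁻¹' Set.Icc s t) (fun z => ‖fderiv ℝ w z‖ₑ) (x + τ • h) := by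
    intro τ
    have h4 : ENNReal.ofReal (t - s) * ‖g' τ‖ₑ
        = ‖deriv σ (ℓ τ)‖ₑ * ‖fderiv ℝ w (x + τ • h) h‖ₑ := by
      rw [← Real.enorm_of_nonneg hd.le, ← enorm_mul, ← enorm_mul]
      congr 1
      simp only [g']
      field_simp
    rw [h4]
    have h5 := hL (ℓ τ)
    by_cases hm : x + τ • h ∈ w ⁻¹' Set.Icc s t
    · rw [Set.indicator_of_mem hm]
      calc _ ≤ (L : ℝ≥0∞) * (‖fderiv ℝ w (x + τ • h)‖ₑ * ‖h‖ₑ) := by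
            refine mul_le_mul' (h5.trans (Set.indicator_le_self' (by simp) _)) ?_
            exact ContinuousLinearMap.le_opENorm _ _
        _ = _ := by ring
    · have : ℓ τ ∉ Set.Icc (0 : ℝ) 1 := by
        intro hmem
        apply hm
        simp only [ℓ, Set.mem_Icc, le_div_iff₀ hd, div_le_iff₀ hd] at hmem
        exact ⟨by linarith [hmem.1], by linarith [hmem.2]⟩
      rw [Set.indicator_of_notMem this] at h5
      rw [nonpos_iff_eq_zero.1 h5]
      simp
  calc ENNReal.ofReal (t - s) = ENNReal.ofReal (t - s) * ‖∫ τ in Set.Ioc (0 : ℝ) 1, g' τ‖ₑ := by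
        rw [hint]; simp
    _ ≤ ENNReal.ofReal (t - s) * ∫⁻ τ in Set.Ioc (0 : ℝ) 1, ‖g' τ‖ₑ := by
        gcongr; exact enorm_integral_le_lintegral_enorm _
    _ = ∫⁻ τ in Set.Ioc (0 : ℝ) 1, ENNReal.ofReal (t - s) * ‖g' τ‖ₑ :=
        (lintegral_const_mul' _ _ ENNReal.ofReal_ne_top).symm
    _ ≤ ∫⁻ τ in Set.Ioc (0 : ℝ) 1, L * ‖h‖ₑ *
        Set.indicator (w ⁻¹' Set.Icc s t) (fun z => ‖fderiv ℝ w z‖ₑ) (x + τ • h) :=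
        lintegral_mono hpt
    _ = _ := lintegral_const_mul' _ _ (by finiteness)

/-- The segment estimate is integrated over all pairs `x`, `x + h` of a low and a high point of the
ball. Convexity keeps the segments inside the ball. -/
theorem exists_measure_mul_measure_le :
    ∃ L : ℝ≥0, ∀ {E : Type} [NormedAddCommGroup E] [InnerProductSpace ℝ E]
      [FiniteDimensional ℝ E] [MeasurableSpace E] [BorelSpace E] (w : E → ℝ),
      ContDiff ℝ 1 w → ∀ (s t : ℝ), s < t → ∀ (c : E) (r : ℝ),
      ENNReal.ofReal (t - s) * (volume (Metric.ball c r ∩ {x | t ≤ w x}) *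
        volume (Metric.ball c r ∩ {x | w x ≤ s}))
      ≤ L * ENNReal.ofReal (2 * r) * volume (Metric.ball (0 : E) (2 * r)) *
        ∫⁻ x in Metric.ball c r ∩ w ⁻¹' Set.Icc s t, ‖fderiv ℝ w x‖ₑ := by
  obtain ⟨L, hL⟩ := exists_segment_estimate
  refine ⟨L, fun {E} _ _ _ _ _ w hw s t hst c r => ?_⟩
  set B := Metric.ball c r with hB
  set A := B ∩ {x | t ≤ w x} with hA
  set Z := B ∩ {x | w x ≤ s} with hZ
  have hwc : Continuous w := hw.continuous
  have hBm : MeasurableSet B := measurableSet_ball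
  have hAm : MeasurableSet A := hBm.inter (measurableSet_le measurable_const hwc.measurable)
  have hZm : MeasurableSet Z := hBm.inter (measurableSet_le hwc.measurable measurable_const)
  have hSm : MeasurableSet (B ∩ w ⁻¹' Set.Icc s t) := hBm.inter (hwc.measurable measurableSet_Icc)
  set F : E → ℝ≥0∞ := Set.indicator (B ∩ w ⁻¹' Set.Icc s t) (fun z => ‖fderiv ℝ w z‖ₑ) with hF
  have hFm : Measurable F :=
    ((hw.continuous_fderiv one_ne_zero).enorm.measurable).indicator hSm
  have hpt : ∀ h x, ENNReal.ofReal (t - s) * (Z.indicator 1 x * A.indicator 1 (x + h)) ≤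
      (Metric.ball (0 : E) (2 * r)).indicator (fun _ => L * ENNReal.ofReal (2 * r)) h *
        ∫⁻ τ in Set.Ioc (0 : ℝ) 1, F (x + τ • h) := by
    intro h x
    by_cases hx : x ∈ Z
    swap
    · simp [hx]
    by_cases hxh : x + h ∈ A
    swap
    · simp [hxh]
    have hh : ‖h‖ < 2 * r := by
      have h1 : dist (x + h) x < r + r :=
        (dist_triangle_right (x + h) x c).trans_lt (add_lt_add hxh.1 hx.1)
      rw [dist_eq_norm, add_sub_cancel_left] at h1
      linarith
    have hhb : h ∈ Metric.ball (0 : E) (2 * r) := by simpa using hh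
    rw [Set.indicator_of_mem hx, Set.indicator_of_mem hxh, Set.indicator_of_mem hhb]
    simp only [Pi.one_apply, mul_one]
    refine (hL w hw s t hst x h hx.2 hxh.2).trans ?_
    have h6 : ‖h‖ₑ ≤ ENNReal.ofReal (2 * r) := by
      rw [← ofReal_norm]; exact ENNReal.ofReal_le_ofReal hh.le
    refine mul_le_mul' (mul_le_mul' le_rfl h6) ?_
    refine setLIntegral_mono' measurableSet_Ioc fun τ hτ => le_of_eq ?_
    have hmem : x + τ • h ∈ B :=
      (convex_ball c r).add_smul_mem hx.1 hxh.1 ⟨hτ.1.le, hτ.2⟩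
    rw [hF, ← Set.indicator_indicator, Set.indicator_of_mem hmem]
  have hleft : ∫⁻ h, ∫⁻ x, ENNReal.ofReal (t - s) * (Z.indicator 1 x * A.indicator 1 (x + h))
      = ENNReal.ofReal (t - s) * (volume A * volume Z) := by
    have hm1 : Measurable (Z.indicator (1 : E → ℝ≥0∞)) := measurable_one.indicator hZm
    have hm2 : Measurable (A.indicator (1 : E → ℝ≥0∞)) := measurable_one.indicator hAm
    rw [lintegral_lintegral_swap (by fun_prop)]
    have : ∀ x, ∫⁻ h, ENNReal.ofReal (t - s) * (Z.indicator 1 x * A.indicator 1 (x + h))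
        = ENNReal.ofReal (t - s) * volume A * Z.indicator 1 x := by
      intro x
      rw [lintegral_const_mul _ (by fun_prop), lintegral_const_mul _ (by fun_prop),
        lintegral_add_left_eq_self (fun h => A.indicator 1 h) x, lintegral_indicator_one hAm]
      ring
    simp_rw [this]
    rw [lintegral_const_mul _ hm1, lintegral_indicator_one hZm, mul_assoc]
  -- By translation invariance every `τ` contributes the same integral.
  have hinner : ∀ h : E, ∫⁻ x, ∫⁻ τ in Set.Ioc (0 : ℝ) 1, F (x + τ • h) = ∫⁻ x, F x := by
    intro h
    rw [lintegral_lintegral_swap (by fun_prop)]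
    simp_rw [lintegral_add_right_eq_self F]
    simp
  rw [← hleft]
  calc _ ≤ ∫⁻ h, ∫⁻ x, (Metric.ball (0 : E) (2 * r)).indicator
          (fun _ => L * ENNReal.ofReal (2 * r)) h * ∫⁻ τ in Set.Ioc (0 : ℝ) 1, F (x + τ • h) :=
        lintegral_mono fun h => lintegral_mono fun x => hpt h x
    _ = ∫⁻ h, (Metric.ball (0 : E) (2 * r)).indicator
          (fun _ => L * ENNReal.ofReal (2 * r)) h * ∫⁻ x, F x := by
        congr 1; ext h
        rw [← hinner h, lintegral_const_mul]
        exact Measurable.lintegral_prod_right' (f := fun p : E × ℝ => F (p.1 + p.2 • h))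
          (by fun_prop)
    _ = _ := by
        rw [lintegral_mul_const _ (measurable_const.indicator measurableSet_ball),
          lintegral_indicator_const measurableSet_ball, hF, lintegral_indicator hSm]

/-! ### Mollification: from C¹ functions to weak gradients -/

/-- Convolution with a bump of mass 1 supported in the `ε`-ball turns `Du` into a classical
gradient, and moves gradient mass by less than `ε`. -/
theorem HasWeakGradient.exists_contDiff_approx {n : ℕ} {u : EuclideanSpace ℝ (Fin n) → ℝ}
    {Du : EuclideanSpace ℝ (Fin n) → EuclideanSpace ℝ (Fin n)} (hD : HasWeakGradient u Du)
    {ε : ℝ} (hε : 0 < ε) {η : ℝ} (hu : ∀ x y, dist x y < ε → dist (u x) (u y) ≤ η) :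
    ∃ w : EuclideanSpace ℝ (Fin n) → ℝ, ContDiff ℝ 1 w ∧ (∀ x, dist (w x) (u x) ≤ η) ∧
      ∀ A A' : Set (EuclideanSpace ℝ (Fin n)), MeasurableSet A → MeasurableSet A' →
        (∀ x ∈ A, Metric.ball x ε ⊆ A') →
        ∫⁻ x in A, ‖fderiv ℝ w x‖ₑ ≤ ∫⁻ x in A', ‖Du x‖ₑ := by
  obtain ⟨hul, hDl, htest⟩ := hD
  let b : ContDiffBump (0 : EuclideanSpace ℝ (Fin n)) := ⟨ε / 2, ε, by linarith, by linarith⟩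
  set φ := b.normed volume with hφ
  have hφs : ContDiff ℝ ∞ φ := b.contDiff_normed
  have hφ1 : ContDiff ℝ 1 φ := b.contDiff_normed (n := 1)
  have hφc : HasCompactSupport φ := b.hasCompactSupport_normed
  have hφ0 : ∀ x, 0 ≤ φ x := b.nonneg_normed
  let L := (ContinuousLinearMap.lsmul ℝ ℝ : ℝ →L[ℝ] ℝ →L[ℝ] ℝ)
  let w := convolution φ u L volume
  have hw : w = convolution u φ L.flip volume := (convolution_flip L).symm
  have hgrad : ∀ x, fderiv ℝ w x =
      InnerProductSpace.toDual ℝ (EuclideanSpace ℝ (Fin n)) (∫ y, φ (x - y) • Du y) := by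
    intro x
    have h1 := (hφc.hasFDerivAt_convolution_right L.flip hul hφ1 x).fderiv
    rw [hw, h1]
    -- The reflected bump is the test function that moves the derivative from `φ` to `u`.
    set ψ : EuclideanSpace ℝ (Fin n) → ℝ := fun y => φ (x - y) with hψ
    have hψs : ContDiff ℝ ∞ ψ := hφs.comp (contDiff_const.sub contDiff_id)
    have hψc : HasCompactSupport ψ := hφc.comp_homeomorph (Homeomorph.subLeft x)
    have hψg : ∀ y, gradient ψ y = - gradient φ (x - y) := by
      intro y
      simp only [gradient]
      rw [← map_neg]
      congr 1
      have h2 : HasFDerivAt φ (fderiv ℝ φ (x - y)) (x - y) :=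
        ((hφ1.differentiable one_ne_zero) _).hasFDerivAt
      have h3 : HasFDerivAt (fun y => x - y)
          (-(ContinuousLinearMap.id ℝ (EuclideanSpace ℝ (Fin n)))) y :=
        (hasFDerivAt_id y).const_sub x
      have h4 := (h2.comp y h3).fderiv
      simp only [hψ]
      refine h4.trans ?_
      ext v; simp
    have h5 := htest ψ hψs hψc
    have h6 : ∫ y, φ (x - y) • Du y = ∫ y, u y • gradient φ (x - y) := by
      have : ∫ y, u y • gradient ψ y = - ∫ y, u y • gradient φ (x - y) := by
        rw [← integral_neg]; congr 1; ext1 y; rw [hψg, smul_neg]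
      rw [this] at h5
      exact (neg_injective h5).symm
    rw [h6]
    have h7 : ∀ y, (L.flip.precompR (EuclideanSpace ℝ (Fin n)) (u y)) (fderiv ℝ φ (x - y))
        = InnerProductSpace.toDual ℝ (EuclideanSpace ℝ (Fin n)) (u y • gradient φ (x - y)) := by
      intro y
      ext v
      simp [gradient, L, mul_comm]
    rw [convolution_def]
    simp_rw [h7]
    have hgc : Continuous fun y => gradient φ (x - y) :=
      (InnerProductSpace.toDual ℝ (EuclideanSpace ℝ (Fin n))).symm.continuous.comp
        ((hφ1.continuous_fderiv one_ne_zero).comp (continuous_const.sub continuous_id))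
    have hgs : HasCompactSupport fun y => gradient φ (x - y) :=
      ((hφc.fderiv ℝ).comp_left
        (g := (InnerProductSpace.toDual ℝ (EuclideanSpace ℝ (Fin n))).symm)
        (map_zero _)).comp_homeomorph (Homeomorph.subLeft x)
    exact (InnerProductSpace.toDual ℝ (EuclideanSpace ℝ
      (Fin n))).toContinuousLinearEquiv.toContinuousLinearMap.integral_comp_commSL (by simp)
        (hul.integrable_smul_right_of_hasCompactSupport hgc hgs)
  have hφint : ∫⁻ x, ENNReal.ofReal (φ x) = 1 := by
    rw [← ofReal_integral_eq_lintegral_ofReal b.integrable_normed (Filter.Eventually.of_forall hφ0),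
      b.integral_normed, ENNReal.ofReal_one]
  refine ⟨w, ?_, ?_, ?_⟩
  · exact hφc.contDiff_convolution_left (n := 1) L hφ1 hul
  · exact fun x => b.dist_normed_convolution_le hul.aestronglyMeasurable fun y hy => hu _ _ hy
  · intro A A' hA hA' hAA'
    have hφm : Measurable φ := hφ1.continuous.measurable
    have hDm : AEMeasurable (fun y => ‖Du y‖ₑ) := hDl.aestronglyMeasurable.enorm
    calc ∫⁻ x in A, ‖fderiv ℝ w x‖ₑ
        ≤ ∫⁻ x in A, ∫⁻ y, ENNReal.ofReal (φ (x - y)) * A'.indicator (fun y => ‖Du y‖ₑ) y := by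
          refine setLIntegral_mono' hA fun x hx => ?_
          rw [hgrad, LinearIsometryEquiv.enorm_map]
          refine (enorm_integral_le_lintegral_enorm _).trans (lintegral_mono fun y => ?_)
          rw [enorm_smul, Real.enorm_of_nonneg (hφ0 _)]
          by_cases hy : y ∈ A'
          · rw [Set.indicator_of_mem hy]
          · have : φ (x - y) = 0 := by
              rw [← Function.notMem_support, hφ, b.support_normed_eq]
              intro hm
              refine hy (hAA' x hx ?_)
              rw [Metric.mem_ball, dist_comm, dist_eq_norm]
              simpa using hm
            simp [this]
      _ ≤ ∫⁻ x, ∫⁻ y, ENNReal.ofReal (φ (x - y)) * A'.indicator (fun y => ‖Du y‖ₑ) y :=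
          setLIntegral_le_lintegral _ _
      _ = ∫⁻ y, ∫⁻ x, ENNReal.ofReal (φ (x - y)) * A'.indicator (fun y => ‖Du y‖ₑ) y := by
          refine lintegral_lintegral_swap (AEMeasurable.mul ?_ ?_)
          · exact (by fun_prop : Measurable fun p : EuclideanSpace ℝ (Fin n) ×
              EuclideanSpace ℝ (Fin n) => ENNReal.ofReal (φ (p.1 - p.2))).aemeasurable
          · exact (hDm.indicator hA').comp_snd
      _ = ∫⁻ y, A'.indicator (fun y => ‖Du y‖ₑ) y := by
          congr 1; ext y
          rw [lintegral_mul_const _ (by fun_prop),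
            lintegral_sub_right_eq_self (fun x => ENNReal.ofReal (φ x)) y, hφint, one_mul]
      _ = _ := lintegral_indicator hA' _

/-- A relative isoperimetric inequality between two level sets. -/
theorem exists_measure_mul_measure_le_of_hasWeakGradient :
    ∃ L : ℝ≥0, ∀ {n : ℕ} (u : EuclideanSpace ℝ (Fin n) → ℝ)
      (Du : EuclideanSpace ℝ (Fin n) → EuclideanSpace ℝ (Fin n)), UniformContinuous u →
      HasWeakGradient u Du → ∀ (s t : ℝ), s < t → ∀ (c : EuclideanSpace ℝ (Fin n)) (r : ℝ), 0 < r →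
      ENNReal.ofReal (t - s) * (volume (Metric.ball c r ∩ {x | t ≤ u x}) *
        volume (Metric.ball c r ∩ {x | u x ≤ s}))
      ≤ L * ENNReal.ofReal r * volume (Metric.ball (0 : EuclideanSpace ℝ (Fin n)) (2 * r)) *
        ∫⁻ x in Metric.ball c (2 * r) ∩ u ⁻¹' Set.Ioo s t, ‖Du x‖ₑ := by
  obtain ⟨L, hL⟩ := exists_measure_mul_measure_le
  refine ⟨4 * L, fun {n} u Du hu hD s t hst c r hr => ?_⟩
  -- If `s + 3η ≤ w x ≤ t - 3η`, then `u` differs from `w x` by at most `2η` on the `ε`-ball of `x`,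
  -- hence stays strictly between `s` and `t`. The shrunken gap is `(t - s) / 2`; this factor 2 and
  -- the one in `2 * r` make `4 * L`.
  set η := (t - s) / 12 with hη
  have hη0 : 0 < η := by rw [hη]; linarith
  obtain ⟨ε₀, hε₀, huε⟩ := Metric.uniformContinuous_iff.1 hu η hη0
  -- `ε ≤ r` keeps the smeared gradient inside the ball of radius `2 * r`.
  set ε := min ε₀ r with hε
  have hε0 : 0 < ε := lt_min hε₀ hr
  have huε' : ∀ x y, dist x y < ε → dist (u x) (u y) ≤ η := fun x y h =>
    (huε (h.trans_le (min_le_left _ _))).le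
  obtain ⟨w, hw, hwu, hwA⟩ := hD.exists_contDiff_approx hε0 huε'
  have hwu' : ∀ x, |w x - u x| ≤ η := hwu
  have key := hL w hw (s + 3 * η) (t - 3 * η) (by rw [hη]; linarith) c r
  have h1 : ∫⁻ x in Metric.ball c r ∩ w ⁻¹' Set.Icc (s + 3 * η) (t - 3 * η), ‖fderiv ℝ w x‖ₑ
      ≤ ∫⁻ x in Metric.ball c (2 * r) ∩ u ⁻¹' Set.Ioo s t, ‖Du x‖ₑ := by
    refine hwA _ _ (measurableSet_ball.inter (hw.continuous.measurable measurableSet_Icc))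
      (measurableSet_ball.inter (hu.continuous.measurable measurableSet_Ioo)) ?_
    rintro x ⟨hxb, hx⟩ y hy
    refine ⟨?_, ?_⟩
    · have := dist_triangle y x c
      rw [Metric.mem_ball] at hxb hy ⊢
      have h2 := min_le_right ε₀ r
      linarith
    · have h3 := huε' y x hy
      rw [Real.dist_eq] at h3
      have h4 := abs_le.1 h3
      have h5 := abs_le.1 (hwu' x)
      exact ⟨by linarith [hx.1], by linarith [hx.2]⟩
  have h2 : Metric.ball c r ∩ {x | t ≤ u x} ⊆ Metric.ball c r ∩ {x | t - 3 * η ≤ w x} := by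
    refine Set.inter_subset_inter_right _ fun x (hx : t ≤ u x) => ?_
    have h5 := abs_le.1 (hwu' x)
    simp only [Set.mem_ofPred_eq]; linarith
  have h3 : Metric.ball c r ∩ {x | u x ≤ s} ⊆ Metric.ball c r ∩ {x | w x ≤ s + 3 * η} := by
    refine Set.inter_subset_inter_right _ fun x (hx : u x ≤ s) => ?_
    have h5 := abs_le.1 (hwu' x)
    simp only [Set.mem_ofPred_eq]; linarith
  have h4 : ENNReal.ofReal (t - s) = 2 * ENNReal.ofReal (t - 3 * η - (s + 3 * η)) := by
    rw [← ENNReal.ofReal_ofNat 2, ← ENNReal.ofReal_mul (by norm_num)]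
    congr 1; rw [hη]; ring
  calc _ ≤ 2 * (ENNReal.ofReal (t - 3 * η - (s + 3 * η)) *
        (volume (Metric.ball c r ∩ {x | t - 3 * η ≤ w x}) *
          volume (Metric.ball c r ∩ {x | w x ≤ s + 3 * η}))) := by
        rw [h4, mul_assoc]; gcongr
    _ ≤ 2 * (L * ENNReal.ofReal (2 * r) *
        volume (Metric.ball (0 : EuclideanSpace ℝ (Fin n)) (2 * r)) *
        ∫⁻ x in Metric.ball c (2 * r) ∩ u ⁻¹' Set.Ioo s t, ‖Du x‖ₑ) := by
        gcongr 2 * ?_; exact key.trans (by gcongr)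
    _ = _ := by
        rw [ENNReal.ofReal_mul (by norm_num), ENNReal.ofReal_ofNat]
        push_cast; ring

/-! ### Balanced balls and boxing for thin slabs -/

theorem volume_ball_eq_pow_mul {m : ℕ} (x : EuclideanSpace ℝ (Fin (m + 1))) {r : ℝ}
    (hr : 0 ≤ r) : volume (Metric.ball x r) = ENNReal.ofReal r ^ (m + 1) *
      volume (Metric.ball (0 : EuclideanSpace ℝ (Fin (m + 1))) 1) := by
  rw [Measure.addHaar_ball volume x hr, ENNReal.ofReal_pow hr]
  simp

theorem volume_ball_two_mul {m : ℕ} (x y : EuclideanSpace ℝ (Fin (m + 1))) {r : ℝ}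
    (hr : 0 ≤ r) : volume (Metric.ball x (2 * r)) = 2 ^ (m + 1) * volume (Metric.ball y r) := by
  rw [volume_ball_eq_pow_mul x (by positivity), volume_ball_eq_pow_mul y hr,
    ENNReal.ofReal_mul (by norm_num), mul_pow, mul_assoc, ENNReal.ofReal_ofNat]

/-- Around every point at which the superlevel set `{t ≤ u}` contains a ball of radius `ρ` there is
a ball in which both `{t ≤ u}` and its complement have a definite proportion of the volume. -/
theorem exists_balanced_radius {m : ℕ} {A : Set (EuclideanSpace ℝ (Fin (m + 1)))} {ρ : ℝ}
    (hρ : 0 < ρ) {K : ℕ}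
    (hK : 2 * volume A < volume (Metric.ball (0 : EuclideanSpace ℝ (Fin (m + 1))) (2 ^ K * ρ)))
    {x : EuclideanSpace ℝ (Fin (m + 1))} (hx : Metric.ball x ρ ⊆ A) :
    ∃ r, ρ ≤ r ∧ r ≤ 2 ^ K * ρ ∧
      volume (Metric.ball x r) ≤ 2 ^ (m + 2) * volume (Metric.ball x r ∩ A) ∧
      2 * volume (Metric.ball x r ∩ A) ≤ volume (Metric.ball x r) := by
  classical
  -- The first dyadic radius at which `A` fills less than half of the ball works: half the radius
  -- was still at least half filled, and doubling costs `2 ^ (m + 1)`. It is not `k = 0`, where the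
  -- ball lies in `A`.
  let P : ℕ → Prop := fun k =>
    2 * volume (Metric.ball x (2 ^ k * ρ) ∩ A) < volume (Metric.ball x (2 ^ k * ρ))
  have hPK : P K := by
    have h1 : volume (Metric.ball x (2 ^ K * ρ)) =
        volume (Metric.ball (0 : EuclideanSpace ℝ (Fin (m + 1))) (2 ^ K * ρ)) :=
      Measure.addHaar_ball_center volume x _
    simp only [P]
    rw [h1]
    refine lt_of_le_of_lt ?_ hK
    gcongr
    exact Set.inter_subset_right
  have hex : ∃ k, P k := ⟨K, hPK⟩
  obtain ⟨k, hk, hmin⟩ : ∃ k, P k ∧ ∀ j < k, ¬ P j :=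
    ⟨Nat.find hex, Nat.find_spec hex, fun j hj => Nat.find_min hex hj⟩
  have hkK : k ≤ K := by
    by_contra h
    exact hmin K (not_le.1 h) hPK
  refine ⟨2 ^ k * ρ, le_mul_of_one_le_left hρ.le (one_le_pow₀ one_le_two), ?_, ?_, hk.le⟩
  · gcongr
    exact one_le_two
  · rcases k with _ | j
    · exfalso
      simp only [P, pow_zero, one_mul, Set.inter_eq_left.2 hx] at hk
      refine absurd hk (not_lt.2 ?_)
      rw [two_mul]
      exact le_self_add
    · have hj := not_lt.1 (hmin j (Nat.lt_succ_self j))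
      have h2 : volume (Metric.ball x (2 ^ (j + 1) * ρ)) =
          2 ^ (m + 1) * volume (Metric.ball x (2 ^ j * ρ)) := by
        rw [← volume_ball_two_mul x x (by positivity)]
        congr 2; ring
      calc volume (Metric.ball x (2 ^ (j + 1) * ρ)) = _ := h2
        _ ≤ 2 ^ (m + 1) * (2 * volume (Metric.ball x (2 ^ j * ρ) ∩ A)) := by gcongr
        _ = 2 ^ (m + 2) * volume (Metric.ball x (2 ^ j * ρ) ∩ A) := by ring
        _ ≤ _ := by
          gcongr
          · exact one_le_two
          · exact Nat.le_succ j

/-- In a balanced ball of volume `V`, `{t ≤ u}` takes at most `V / 2` and the thin slab at most `V /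
4`, so `{u ≤ s}` has at least `V / 4`. The isoperimetric product is then comparable to `V ^ 2`;
cancelling `V` and one factor `r` leaves `r ^ m`. -/
theorem exists_pow_radius_le_lintegral (m : ℕ) :
    ∃ C : ℝ≥0∞, C ≠ ⊤ ∧ ∀ (u : EuclideanSpace ℝ (Fin (m + 1)) → ℝ)
      (Du : EuclideanSpace ℝ (Fin (m + 1)) → EuclideanSpace ℝ (Fin (m + 1))),
      UniformContinuous u → HasWeakGradient u Du → ∀ (s t : ℝ), s < t → ∀ (ρ : ℝ), 0 < ρ →
      4 * volume (u ⁻¹' Set.Ioo s t) ≤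
        volume (Metric.ball (0 : EuclideanSpace ℝ (Fin (m + 1))) ρ) →
      ∀ K : ℕ, 2 * volume {y | t ≤ u y} <
        volume (Metric.ball (0 : EuclideanSpace ℝ (Fin (m + 1))) (2 ^ K * ρ)) →
      ∀ x, Metric.ball x ρ ⊆ {y | t ≤ u y} → ∃ r, 0 < r ∧ r ≤ 2 ^ K * ρ ∧
        ENNReal.ofReal (t - s) * ENNReal.ofReal r ^ m ≤
          C * ∫⁻ y in Metric.ball x (2 * r) ∩ u ⁻¹' Set.Ioo s t, ‖Du y‖ₑ := by
  obtain ⟨L, hL⟩ := exists_measure_mul_measure_le_of_hasWeakGradient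
  set ω₁ := volume (Metric.ball (0 : EuclideanSpace ℝ (Fin (m + 1))) 1) with hω
  have hω0 : ω₁ ≠ 0 := (Metric.measure_ball_pos volume _ one_pos).ne'
  have hωt : ω₁ ≠ ⊤ := Metric.isBounded_ball.measure_lt_top.ne
  refine ⟨2 ^ (2 * m + 5) * L * ω₁⁻¹, by finiteness, ?_⟩
  intro u Du hu hD s t hst ρ hρ hslab K hK x hx
  obtain ⟨r, hρr, hrK, h1, h2⟩ := exists_balanced_radius hρ hK hx
  have hr : 0 < r := hρ.trans_le hρr
  refine ⟨r, hr, hrK, ?_⟩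
  set V := volume (Metric.ball x r) with hV
  set a := volume (Metric.ball x r ∩ {y | t ≤ u y}) with ha
  set z := volume (Metric.ball x r ∩ {y | u y ≤ s}) with hz
  set I := ∫⁻ y in Metric.ball x (2 * r) ∩ u ⁻¹' Set.Ioo s t, ‖Du y‖ₑ with hI
  have hVt : V ≠ ⊤ := Metric.isBounded_ball.measure_lt_top.ne
  have hV0 : V ≠ 0 := (Metric.measure_ball_pos volume _ hr).ne'
  have h3 : V ≤ a + volume (u ⁻¹' Set.Ioo s t) + z := by
    have : Metric.ball x r ⊆ (Metric.ball x r ∩ {y | t ≤ u y}) ∪ u ⁻¹' Set.Ioo s t ∪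
        (Metric.ball x r ∩ {y | u y ≤ s}) := by
      intro y hy
      rcases le_or_gt t (u y) with h | h
      · exact Or.inl (Or.inl ⟨hy, h⟩)
      · rcases le_or_gt (u y) s with h' | h'
        · exact Or.inr ⟨hy, h'⟩
        · exact Or.inl (Or.inr ⟨h', h⟩)
    exact (measure_mono this).trans ((measure_union_le _ _).trans
      (add_le_add_left (measure_union_le _ _) _))
  have h4 : 4 * volume (u ⁻¹' Set.Ioo s t) ≤ V := by
    refine hslab.trans ?_
    rw [hV, Measure.addHaar_ball_center volume x r]
    exact measure_mono (Metric.ball_subset_ball hρr)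
  have h5 : V ≤ 4 * z := by
    have : 3 * V + V ≤ 3 * V + 4 * z := by
      calc 3 * V + V = 4 * V := by ring
        _ ≤ 4 * (a + volume (u ⁻¹' Set.Ioo s t) + z) := by gcongr
        _ = 2 * (2 * a) + 4 * volume (u ⁻¹' Set.Ioo s t) + 4 * z := by ring
        _ ≤ 2 * V + V + 4 * z := by gcongr
        _ = _ := by ring
    exact (ENNReal.add_le_add_iff_left (by finiteness)).1 this
  have h6 := hL u Du hu hD s t hst x r hr
  rw [volume_ball_two_mul 0 x hr.le, ← hV, ← ha, ← hz, ← hI] at h6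
  have h7 : (ENNReal.ofReal (t - s) * V) * V ≤
      (2 ^ (2 * m + 5) * L * ENNReal.ofReal r * I) * V := by
    calc (ENNReal.ofReal (t - s) * V) * V
        ≤ (ENNReal.ofReal (t - s) * (2 ^ (m + 2) * a)) * (4 * z) := by gcongr
      _ = 2 ^ (m + 2) * 4 * (ENNReal.ofReal (t - s) * (a * z)) := by ring
      _ ≤ 2 ^ (m + 2) * 4 * (L * ENNReal.ofReal r * (2 ^ (m + 1) * V) * I) := by gcongr
      _ = _ := by ring
  have h8 := (ENNReal.mul_le_mul_iff_left hV0 hVt).1 h7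
  have hr0 : ENNReal.ofReal r ≠ 0 := by simpa using hr
  rw [hV, volume_ball_eq_pow_mul x hr.le, ← hω] at h8
  have h9 : (ENNReal.ofReal (t - s) * ENNReal.ofReal r ^ m * ω₁) * ENNReal.ofReal r ≤
      (2 ^ (2 * m + 5) * L * I) * ENNReal.ofReal r := by
    calc _ = ENNReal.ofReal (t - s) * (ENNReal.ofReal r ^ (m + 1) * ω₁) := by ring
      _ ≤ _ := h8
      _ = _ := by ring
  have h10 := (ENNReal.mul_le_mul_iff_left hr0 ENNReal.ofReal_ne_top).1 h9
  calc _ = (ENNReal.ofReal (t - s) * ENNReal.ofReal r ^ m * ω₁) * ω₁⁻¹ := by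
        rw [mul_assoc _ ω₁, ENNReal.mul_inv_cancel hω0 hωt, mul_one]
    _ ≤ (2 ^ (2 * m + 5) * L * I) * ω₁⁻¹ := by gcongr
    _ = _ := by ring

/-- A boxing inequality for a slab `{s < u < t}` of small volume. -/
theorem exists_hausdorffContent_le_of_thin_slab (m : ℕ) (hm : 0 < m) :
    ∃ C : ℝ≥0∞, C ≠ ⊤ ∧ ∀ (u : EuclideanSpace ℝ (Fin (m + 1)) → ℝ)
      (Du : EuclideanSpace ℝ (Fin (m + 1)) → EuclideanSpace ℝ (Fin (m + 1))),
      UniformContinuous u → HasWeakGradient u Du → ∀ (s t : ℝ), s < t → ∀ (ρ : ℝ), 0 < ρ →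
      4 * volume (u ⁻¹' Set.Ioo s t) ≤
        volume (Metric.ball (0 : EuclideanSpace ℝ (Fin (m + 1))) ρ) →
      volume {y | t ≤ u y} ≠ ⊤ →
      ∀ E : Set (EuclideanSpace ℝ (Fin (m + 1))),
        (∀ x ∈ E, Metric.ball x ρ ⊆ {y | t ≤ u y}) →
        ENNReal.ofReal (t - s) * hausdorffContent m E ≤
          C * ∫⁻ y in u ⁻¹' Set.Ioo s t, ‖Du y‖ₑ := by
  obtain ⟨C, hC, hmain⟩ := exists_pow_radius_le_lintegral m
  refine ⟨11 ^ m * C, by finiteness, fun u Du hu hD s t hst ρ hρ hslab hfin E hE => ?_⟩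
  obtain ⟨K, hK⟩ : ∃ K : ℕ, 2 * volume {y | t ≤ u y} <
      volume (Metric.ball (0 : EuclideanSpace ℝ (Fin (m + 1))) (2 ^ K * ρ)) := by
    obtain ⟨K, hK⟩ := ENNReal.exists_nat_mul_gt
      (Metric.measure_ball_pos volume (0 : EuclideanSpace ℝ (Fin (m + 1))) hρ).ne'
      (by finiteness : 2 * volume {y | t ≤ u y} ≠ ⊤)
    refine ⟨K, hK.trans_le ?_⟩
    have h1 : (K : ℝ≥0∞) ≤ 2 ^ K := by exact_mod_cast Nat.lt_two_pow_self.le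
    rw [volume_ball_eq_pow_mul _ hρ.le, volume_ball_eq_pow_mul _ (by positivity : 0 ≤ 2 ^ K * ρ),
      ENNReal.ofReal_mul (by positivity), mul_pow, mul_assoc, ENNReal.ofReal_pow (by norm_num),
      ENNReal.ofReal_ofNat]
    gcongr
    exact h1.trans (le_self_pow₀ (one_le_pow₀ one_le_two) (Nat.succ_ne_zero m))
  choose! r hr0 hrK hr using fun x (hx : x ∈ E) =>
    hmain u Du hu hD s t hst ρ hρ hslab K hK x (hE x hx)
  -- Disjointness of the balls of radius `2 * r x` lets the integrals add up. The fivefold closed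
  -- balls have radius `10 * r x` and fit in open balls of radius `11 * r x`, whence `11 ^ m`.
  obtain ⟨F, hFE, hdisj, hcov⟩ := Vitali.exists_disjoint_subfamily_covering_enlargement_closedBall
    E id (fun x => 2 * r x) (2 * (2 ^ K * ρ)) (fun x hx => by have := hrK x hx; linarith)
    5 (by norm_num)
  have hFc : F.Countable := hdisj.countable_of_nonempty_interior fun x hx => by
    have : Metric.ball x (2 * r x) ⊆ interior (Metric.closedBall (id x) (2 * r x)) :=
      Metric.ball_subset_interior_closedBall
    exact ⟨x, this (Metric.mem_ball_self (by have := hr0 x (hFE hx); linarith))⟩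
  have := hFc.to_subtype
  have hcover : E ⊆ ⋃ x : F, Metric.ball (x : EuclideanSpace ℝ (Fin (m + 1)))
      ((11 * (r x).toNNReal : ℝ≥0) : ℝ) := by
    intro y hy
    obtain ⟨x, hx, hyx⟩ := hcov y hy
    have hry := hr0 y hy
    have hrx := hr0 x (hFE hx)
    refine Set.mem_iUnion.2 ⟨⟨x, hx⟩, ?_⟩
    have h1 : y ∈ Metric.closedBall (id x) (5 * (2 * r x)) :=
      hyx (Metric.mem_closedBall_self (by linarith))
    rw [Metric.mem_closedBall] at h1
    rw [Metric.mem_ball]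
    push_cast
    rw [Real.coe_toNNReal _ hrx.le]
    simp only [id] at h1
    linarith
  calc ENNReal.ofReal (t - s) * hausdorffContent m E
      ≤ ENNReal.ofReal (t - s) * ∑' x : F, ((11 * (r x).toNNReal : ℝ≥0) : ℝ≥0∞) ^ (m : ℝ) := by
        gcongr
        exact hausdorffContent_le_tsum (by exact_mod_cast hm) _ _ hcover
    _ = ∑' x : F, 11 ^ m * (ENNReal.ofReal (t - s) * ENNReal.ofReal (r x) ^ m) := by
        rw [← ENNReal.tsum_mul_left]
        congr 1; ext x
        rw [ENNReal.rpow_natCast, ENNReal.coe_mul, mul_pow]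
        simp only [ENNReal.ofReal]
        push_cast
        ring
    _ ≤ ∑' x : F, 11 ^ m * (C * ∫⁻ y in Metric.ball (x : EuclideanSpace ℝ (Fin (m + 1)))
          (2 * r x) ∩ u ⁻¹' Set.Ioo s t, ‖Du y‖ₑ) :=
        ENNReal.tsum_le_tsum fun x => by
          gcongr 11 ^ m * ?_
          exact hr x (hFE x.2)
    _ = 11 ^ m * C * ∫⁻ y in ⋃ x : F, Metric.ball (x : EuclideanSpace ℝ (Fin (m + 1)))
          (2 * r x) ∩ u ⁻¹' Set.Ioo s t, ‖Du y‖ₑ := by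
        rw [lintegral_iUnion, ENNReal.tsum_mul_left, ENNReal.tsum_mul_left, mul_assoc]
        · exact fun x => measurableSet_ball.inter (hu.continuous.measurable measurableSet_Ioo)
        · intro x y hxy
          refine Disjoint.mono ?_ ?_ (hdisj x.2 y.2 (Subtype.coe_ne_coe.2 hxy))
          · exact Set.inter_subset_left.trans Metric.ball_subset_closedBall
          · exact Set.inter_subset_left.trans Metric.ball_subset_closedBall
    _ ≤ _ := by
        gcongr
        exact Set.iUnion_subset fun x => Set.inter_subset_right

/-! ### Slicing by levels: boxing for arbitrary slabs -/

theorem sum_setLIntegral_preimage_Ioo_le {α : Type*} [MeasurableSpace α] {μ : Measure α}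
    {u : α → ℝ} (hu : Measurable u) {t : ℕ → ℝ} (ht : Monotone t) (f : α → ℝ≥0∞) (N : ℕ) :
    ∑ i ∈ Finset.range N, ∫⁻ x in u ⁻¹' Set.Ioo (t i) (t (i + 1)), f x ∂μ
      ≤ ∫⁻ x in u ⁻¹' Set.Ioo (t 0) (t N), f x ∂μ := by
  rw [← lintegral_biUnion_finset _ fun i _ => hu measurableSet_Ioo]
  · refine lintegral_mono_set (Set.iUnion₂_subset fun i hi => Set.preimage_mono ?_)
    exact Set.Ioo_subset_Ioo (ht (Nat.zero_le i)) (ht (Finset.mem_range.1 hi))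
  · intro i _ j _ hij
    exact (ht.pairwise_disjoint_on_Ioo_succ hij).preimage u

theorem sum_measure_preimage_Ioo_le {α : Type*} [MeasurableSpace α] {μ : Measure α}
    {u : α → ℝ} (hu : Measurable u) {t : ℕ → ℝ} (ht : Monotone t) (N : ℕ) :
    ∑ i ∈ Finset.range N, μ (u ⁻¹' Set.Ioo (t i) (t (i + 1))) ≤ μ (u ⁻¹' Set.Ioo (t 0) (t N)) := by
  simpa using sum_setLIntegral_preimage_Ioo_le (μ := μ) hu ht 1 N

theorem HasCompactSupport.isBounded_superlevel {X : Type*} [PseudoMetricSpace X] {u : X → ℝ}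
    (hu : HasCompactSupport u) {t : ℝ} (ht : 0 < t) : Bornology.IsBounded {y | t ≤ u y} := by
  refine hu.isCompact.isBounded.subset fun y (hy : t ≤ u y) => subset_tsupport u ?_
  rw [Function.mem_support]
  linarith

/-- The capacitary boxing inequality. -/
theorem exists_hausdorffContent_superlevel_le (m : ℕ) (hm : 0 < m) :
    ∃ C : ℝ≥0∞, C ≠ ⊤ ∧ ∀ (u : EuclideanSpace ℝ (Fin (m + 1)) → ℝ)
      (Du : EuclideanSpace ℝ (Fin (m + 1)) → EuclideanSpace ℝ (Fin (m + 1))),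
      Continuous u → HasCompactSupport u → HasWeakGradient u Du → ∀ S T : ℝ, 0 < S → S < T →
        ENNReal.ofReal (T - S) * hausdorffContent m {y | T ≤ u y} ≤
          C * ∫⁻ y in u ⁻¹' Set.Ioo S T, ‖Du y‖ₑ := by
  obtain ⟨C, hC, hmain⟩ := exists_hausdorffContent_le_of_thin_slab m hm
  refine ⟨4 * C, by finiteness, fun u Du hu hus hD S T hS hST => ?_⟩
  have huu : UniformContinuous u := hus.uniformContinuous_of_continuous hu
  have hT : 0 < T := hS.trans hST
  have hfin : ∀ t, 0 < t → volume {y | t ≤ u y} ≠ ⊤ := fun t ht =>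
    (hus.isBounded_superlevel ht).measure_lt_top.ne
  -- On the `ρ`-ball of a point of `{T ≤ u}`, `u` exceeds `(S + T) / 2`, so these balls lie above
  -- every level used below.
  obtain ⟨ρ, hρ, hρu⟩ := Metric.uniformContinuous_iff.1 huu ((T - S) / 2) (by linarith)
  set E := {y | T ≤ u y} with hE
  set H := hausdorffContent m E with hH
  have hHt : H ≠ ⊤ := (hausdorffContent_lt_top_of_isBounded (by exact_mod_cast hm)
    (hus.isBounded_superlevel hT)).ne
  set β := volume (Metric.ball (0 : EuclideanSpace ℝ (Fin (m + 1))) ρ) with hβ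
  have hβ0 : β ≠ 0 := (Metric.measure_ball_pos volume _ hρ).ne'
  have hβt : β ≠ ⊤ := Metric.isBounded_ball.measure_lt_top.ne
  have hv := hfin S hS
  -- Thick slabs have volume above `β / 4`, so this `N` makes them at most half of all slabs.
  obtain ⟨N, hN⟩ := ENNReal.exists_nat_mul_gt hβ0 (by finiteness : 8 * volume {y | S ≤ u y} ≠ ⊤)
  have hN0 : 0 < N := by
    rcases Nat.eq_zero_or_pos N with rfl | h
    · simp at hN
    · exact h
  have hN0' : (0 : ℝ) < N := by exact_mod_cast hN0
  set d : ℝ := (T - S) / (2 * N) with hd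
  have hd0 : 0 < d := div_pos (by linarith) (by positivity)
  have hNd : N * d = (T - S) / 2 := by rw [hd]; field_simp
  set t : ℕ → ℝ := fun i => S + i * d with ht
  have htm : StrictMono t := fun i j hij => by
    simp only [ht]; gcongr
  have ht0 : t 0 = S := by simp [ht]
  have htN : t N = (S + T) / 2 := by simp only [ht, hNd]; ring
  have htd : ∀ i, t (i + 1) - t i = d := fun i => by simp only [ht]; push_cast; ring
  set I := ∫⁻ y in u ⁻¹' Set.Ioo S T, ‖Du y‖ₑ with hI
  -- A thin slab is paid for by the gradient term. For a thick one the last factor is at least 1;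
  -- summed over `i`, these terms are at most `Q / 2` and are absorbed on the left.
  have hterm : ∀ i ∈ Finset.range N, ENNReal.ofReal d * H ≤
      C * (∫⁻ y in u ⁻¹' Set.Ioo (t i) (t (i + 1)), ‖Du y‖ₑ) +
        ENNReal.ofReal d * H * (4 * β⁻¹ * volume (u ⁻¹' Set.Ioo (t i) (t (i + 1)))) := by
    intro i hi
    have hle : t (i + 1) ≤ (S + T) / 2 := htN ▸ htm.monotone (Finset.mem_range.1 hi)
    have hlt : t i < t (i + 1) := htm (Nat.lt_succ_self i)
    by_cases hs : 4 * volume (u ⁻¹' Set.Ioo (t i) (t (i + 1))) ≤ β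
    · refine le_add_right ?_
      rw [← htd i]
      refine hmain u Du huu hD _ _ hlt ρ hρ hs (hfin _ ?_) E fun x hx y hy => ?_
      · have := htm.monotone (Nat.zero_le (i + 1))
        linarith
      · have h1 := hρu hy
        rw [Real.dist_eq] at h1
        have h2 := (abs_lt.1 h1).1
        have h3 : T ≤ u x := hx
        simp only [Set.mem_ofPred_eq]
        linarith
    · refine le_add_left ?_
      refine le_mul_of_one_le_right zero_le ?_
      calc (1 : ℝ≥0∞) = β⁻¹ * β := (ENNReal.inv_mul_cancel hβ0 hβt).symm
        _ ≤ β⁻¹ * (4 * volume (u ⁻¹' Set.Ioo (t i) (t (i + 1)))) := by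
          gcongr; exact (not_le.1 hs).le
        _ = _ := by ring
  have hsum := Finset.sum_le_sum hterm
  rw [Finset.sum_const, Finset.card_range, nsmul_eq_mul, Finset.sum_add_distrib, ← Finset.mul_sum,
    ← Finset.mul_sum, ← Finset.mul_sum] at hsum
  have h1 : ∑ i ∈ Finset.range N, ∫⁻ y in u ⁻¹' Set.Ioo (t i) (t (i + 1)), ‖Du y‖ₑ ≤ I := by
    refine (sum_setLIntegral_preimage_Ioo_le hu.measurable htm.monotone _ N).trans ?_
    refine lintegral_mono_set (Set.preimage_mono ?_)
    rw [ht0, htN]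
    exact Set.Ioo_subset_Ioo le_rfl (by linarith)
  have h2 : ∑ i ∈ Finset.range N, volume (u ⁻¹' Set.Ioo (t i) (t (i + 1)))
      ≤ volume {y | S ≤ u y} := by
    refine (sum_measure_preimage_Ioo_le hu.measurable htm.monotone N).trans (measure_mono ?_)
    rw [ht0]
    exact fun y hy => hy.1.le
  set Q := (N : ℝ≥0∞) * (ENNReal.ofReal d * H) with hQ
  have hQt : Q ≠ ⊤ := by finiteness
  have h3 : 2 * (ENNReal.ofReal d * H *
      (4 * β⁻¹ * ∑ i ∈ Finset.range N, volume (u ⁻¹' Set.Ioo (t i) (t (i + 1))))) ≤ Q := by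
    calc _ ≤ 2 * (ENNReal.ofReal d * H * (4 * β⁻¹ * volume {y | S ≤ u y})) := by gcongr
      _ = ENNReal.ofReal d * H * β⁻¹ * (8 * volume {y | S ≤ u y}) := by ring
      _ ≤ ENNReal.ofReal d * H * β⁻¹ * (N * β) := by gcongr
      _ = Q * (β⁻¹ * β) := by rw [hQ]; ring
      _ = Q := by rw [ENNReal.inv_mul_cancel hβ0 hβt, mul_one]
  have h4 : Q ≤ 2 * (C * I) := by
    have : Q + Q ≤ Q + 2 * (C * I) := by
      calc Q + Q = 2 * Q := by ring
        _ ≤ 2 * (C * I + ENNReal.ofReal d * H *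
            (4 * β⁻¹ * ∑ i ∈ Finset.range N, volume (u ⁻¹' Set.Ioo (t i) (t (i + 1))))) := by
          gcongr 2 * ?_
          exact hsum.trans (by gcongr)
        _ ≤ 2 * (C * I) + Q := by rw [mul_add]; gcongr
        _ = _ := add_comm _ _
    exact (ENNReal.add_le_add_iff_left hQt).1 this
  have h5 : ENNReal.ofReal (T - S) * H = 2 * Q := by
    have : T - S = 2 * (N * d) := by rw [hNd]; ring
    rw [this, ENNReal.ofReal_mul (by norm_num), ENNReal.ofReal_mul hN0'.le, ENNReal.ofReal_natCast,
      ENNReal.ofReal_ofNat, hQ]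
    ring
  calc _ = 2 * Q := h5
    _ ≤ 2 * (2 * (C * I)) := by gcongr
    _ = _ := by ring

/-! ### Summing over levels and the main theorem -/

/-- Since `x ≥ 1 + log x`, the sum is at least `N` plus a telescoping sum of logarithms, whose drop
is at most `N / 2`. -/
theorem half_le_sum_ratio {k : ℕ → ℝ} {N : ℕ} (hk : ∀ i ≤ N, 0 < k i)
    (hN : 2 * (Real.log (k 0) - Real.log (k N)) ≤ N) :
    (N : ℝ) / 2 ≤ ∑ i ∈ Finset.range N, k (i + 1) / k i := by
  have h1 : ∀ i ∈ Finset.range N, 1 + (Real.log (k (i + 1)) - Real.log (k i)) ≤ k (i + 1) / k i := by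
    intro i hi
    have hi' := Finset.mem_range.1 hi
    have h2 := hk i hi'.le
    have h3 := hk (i + 1) hi'
    rw [← Real.log_div h3.ne' h2.ne']
    linarith [Real.log_le_sub_one_of_pos (div_pos h3 h2)]
  have h4 := Finset.sum_le_sum h1
  rw [Finset.sum_add_distrib, Finset.sum_range_sub fun i => Real.log (k i)] at h4
  simp only [Finset.sum_const, Finset.card_range, nsmul_eq_mul, mul_one] at h4
  linarith

theorem exists_le_lintegral_div_hausdorffContent (m : ℕ) (hm : 0 < m) :
    ∃ C : ℝ≥0∞, C ≠ ⊤ ∧ ∀ (u : EuclideanSpace ℝ (Fin (m + 1)) → ℝ)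
      (Du : EuclideanSpace ℝ (Fin (m + 1)) → EuclideanSpace ℝ (Fin (m + 1))),
      Continuous u → HasCompactSupport u → HasWeakGradient u Du → ∀ x₀,
        ENNReal.ofReal (u x₀) ≤ C * ∫⁻ x, ‖Du x‖ₑ / hausdorffContent m {y | u x ≤ u y} := by
  obtain ⟨C, hC, hmain⟩ := exists_hausdorffContent_superlevel_le m hm
  have hm' : (0 : ℝ) < m := by exact_mod_cast hm
  refine ⟨4 * C, by finiteness, fun u Du hu hus hD x₀ => ?_⟩
  rcases le_or_gt (u x₀) 0 with hM | hM
  · simp [ENNReal.ofReal_of_nonpos hM]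
  set M := u x₀ with hMdef
  set h : ℝ → ℝ≥0∞ := fun t => hausdorffContent m {y | t ≤ u y} with hh
  have hanti : Antitone h := fun s t hst => hausdorffContent_mono fun y (hy : t ≤ u y) =>
    hst.trans hy
  have hfin : ∀ t, 0 < t → h t ≠ ⊤ := fun t ht =>
    (hausdorffContent_lt_top_of_isBounded hm' (hus.isBounded_superlevel ht)).ne
  have hpos : ∀ t, t < M → h t ≠ 0 := fun t ht => by
    refine ((hausdorffContent_pos_of_isOpen (U := {y | t < u y}) hm' (by push_cast; simp)
      (isOpen_lt continuous_const hu) ⟨x₀, ht⟩).trans_le (hausdorffContent_mono ?_)).ne'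
    exact fun y (hy : t < u y) => hy.le
  -- Levels in `[M / 4, 3 * M / 4]` stay away from 0, where the content could be infinite, and from
  -- `M`, where it could vanish. So the logarithms are meaningful and a finite `N` beats their drop.
  obtain ⟨N, hN⟩ := exists_nat_ge
    (max 1 (2 * (Real.log (h (M / 4)).toReal - Real.log (h (3 * M / 4)).toReal)))
  have hN1 : (1 : ℝ) ≤ N := (le_max_left _ _).trans hN
  have hN0 : (0 : ℝ) < N := by linarith
  set d : ℝ := M / (2 * N) with hd
  have hd0 : 0 < d := by positivity
  have hNd : N * d = M / 2 := by rw [hd]; field_simp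
  set t : ℕ → ℝ := fun i => M / 4 + i * d with ht
  have htm : StrictMono t := fun i j hij => by
    simp only [ht]; gcongr
  have ht0 : t 0 = M / 4 := by simp [ht]
  have htN : t N = 3 * M / 4 := by simp only [ht, hNd]; ring
  have htd : ∀ i, t (i + 1) - t i = d := fun i => by simp only [ht]; push_cast; ring
  have htpos : ∀ i, 0 < t i := fun i => by simp only [ht]; positivity
  have htM : ∀ i ≤ N, t i < M := fun i hi => by
    have := htm.monotone hi
    linarith
  set f : EuclideanSpace ℝ (Fin (m + 1)) → ℝ≥0∞ := fun x => ‖Du x‖ₑ / h (u x) with hf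
  have hterm : ∀ i ∈ Finset.range N, ENNReal.ofReal (d * ((h (t (i + 1))).toReal / (h (t i)).toReal))
      ≤ C * ∫⁻ x in u ⁻¹' Set.Ioo (t i) (t (i + 1)), f x := by
    intro i hi
    have hi' := Finset.mem_range.1 hi
    have h0 := hpos (t i) (htM i hi'.le)
    have h1 := hmain u Du hu hus hD (t i) (t (i + 1)) (htpos i) (htm (Nat.lt_succ_self i))
    rw [htd] at h1
    calc ENNReal.ofReal (d * ((h (t (i + 1))).toReal / (h (t i)).toReal))
        = ENNReal.ofReal d * h (t (i + 1)) * (h (t i))⁻¹ := by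
          rw [ENNReal.ofReal_mul hd0.le, ← ENNReal.toReal_div, ENNReal.ofReal_toReal
            (ENNReal.div_ne_top (hfin _ (htpos _)) h0), div_eq_mul_inv, mul_assoc]
      _ ≤ C * (∫⁻ y in u ⁻¹' Set.Ioo (t i) (t (i + 1)), ‖Du y‖ₑ) * (h (t i))⁻¹ := by
          gcongr
      _ = C * ∫⁻ y in u ⁻¹' Set.Ioo (t i) (t (i + 1)), ‖Du y‖ₑ * (h (t i))⁻¹ := by
          rw [lintegral_mul_const' _ _ (ENNReal.inv_ne_top.2 h0), mul_assoc]
      _ ≤ _ := by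
          gcongr C * ?_
          refine setLIntegral_mono' (hu.measurable measurableSet_Ioo) fun y hy => ?_
          simp only [hf, div_eq_mul_inv]
          gcongr
          exact hanti hy.1.le
  have hratio := half_le_sum_ratio (k := fun i => (h (t i)).toReal) (N := N)
    (fun i hi => ENNReal.toReal_pos (hpos _ (htM i hi)) (hfin _ (htpos i)))
    (by simp only [ht0, htN]; exact (le_max_right _ _).trans hN)
  have hsum := Finset.sum_le_sum hterm
  rw [← Finset.mul_sum, ← ENNReal.ofReal_sum_of_nonneg (fun i _ => by positivity),
    ← Finset.mul_sum] at hsum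
  -- `N * d = M / 2` and an average ratio of at least 1/2 give `M / 4`, hence the factor 4.
  calc ENNReal.ofReal M = 4 * ENNReal.ofReal (d * (N / 2)) := by
        rw [← ENNReal.ofReal_ofNat 4, ← ENNReal.ofReal_mul (by norm_num)]
        congr 1; linarith
    _ ≤ 4 * (C * ∑ i ∈ Finset.range N, ∫⁻ x in u ⁻¹' Set.Ioo (t i) (t (i + 1)), f x) := by
        gcongr 4 * ?_
        refine le_trans ?_ hsum
        gcongr
    _ ≤ 4 * (C * ∫⁻ x, f x) := by
        gcongr
        exact (sum_setLIntegral_preimage_Ioo_le hu.measurable htm.monotone f N).trans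
          (setLIntegral_le_lintegral _ _)
    _ = _ := (mul_assoc _ _ _).symm

theorem theorem4p3 (n : ℕ) (hn : 2 ≤ n) (κ : ℝ) (hκ₀ : 0 ≤ κ) (hκ₁ : κ ≤ 1) :
    ∃ c : ℝ, 0 < c ∧
      ∀ (u : EuclideanSpace ℝ (Fin n) → ℝ)
        (Du : EuclideanSpace ℝ (Fin n) → EuclideanSpace ℝ (Fin n)),
        (∀ x, 0 ≤ u x) → Continuous u → HasCompactSupport u →
        MemW110 u → HasWeakGradient u Du →
        eLpNorm u ⊤ volume ≤
          ENNReal.ofReal c *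
            ∫⁻ x, ‖Du x‖ₑ /
              hausdorffContent ((n : ℝ) - κ) {y | u x ≤ u y} ^ (((n : ℝ) - 1) / ((n : ℝ) - κ)) := by
  
  obtain ⟨m, rfl⟩ : ∃ m, n = m + 1 := ⟨n - 1, by omega⟩
  have hm : 0 < m := by omega
  have hm1 : (1 : ℝ) ≤ m := by exact_mod_cast hm
  have hcast : ((m + 1 : ℕ) : ℝ) - 1 = m := by push_cast; ring
  obtain ⟨C, hC, hmain⟩ := exists_le_lintegral_div_hausdorffContent m hm
  refine ⟨C.toReal + 1, by positivity, fun u Du hu0 hu hus _ hD => ?_⟩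
  have hCc : C ≤ ENNReal.ofReal (C.toReal + 1) := by
    rw [← ENNReal.ofReal_toReal hC]
    exact ENNReal.ofReal_le_ofReal (by simp)
  rw [eLpNorm_exponent_top]
  refine essSup_le_of_ae_le _ (Filter.Eventually.of_forall fun x₀ => ?_)
  refine (Real.enorm_of_nonneg (hu0 x₀)).trans_le ?_
  refine (hmain u Du hu hus hD x₀).trans ?_
  refine mul_le_mul' hCc (lintegral_mono fun x => ENNReal.div_le_div_left ?_ _)
  rw [hcast]
  -- Exponents `n - 1 ≤ n - κ`: this is where `κ ≤ 1` enters.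
  refine hausdorffContent_rpow_le (by linarith) ?_ _
  push_cast
  linarith
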